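/- Setting. $N$ qudits of local dimension $q$ with local basis $|0\rangle,\dots,|q-1\rangle$ sit on the vertices of a finite graph with vertex set $\Lambda$, $|\Lambda|=N$; $\mathsf d$ is the graph distance, $\mathrm{diam}\,S=\max_{i,j\in S}\mathsf d(i,j)$, and a set $S\subset\Lambda$ is connected if any two of its sites are joined by a path inside $S$. The graph is $d$-dimensional with constant $c_d$ ($d\ge 1$ an integer, $c_d>0$): for every connected $S\subset\Lambda$, $$|\partial S|\le c_d\max(1,\mathrm{diam}\,S)^{d-1},\qquad |S|\le c_d\max(1,\mathrm{diam}\,S)^{d},$$ where $\partial S$ is the set of sites of $S$ at distance $1$ from $S^{\mathrm c}$. All operator decompositions $\mathcal O=\sum_S\mathcal O_S$ run over connected sets $S$, with $\mathcal O_S$ acting as the identity outside $S$; $\|\cdot\|$ is the operator norm, and $|\mathbf 0\rangle$ is the all-zero product state. For a Hermitian operator $H$ put $H[|\psi\rangle]=\langle\psi|H|\psi\rangle/\langle\psi|\psi\rangle$ if $|\psi\rangle\neq 0$ and $H[0]=+\infty$. The pair $(H,|\psi_0\rangle)$ is called $(\Delta,R)$-metastable if $R\ge 1$ and $$H\big[(\mathcal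 O-\langle\mathcal O\rangle_{\psi_0})|\psi_0\rangle\big]-H[|\psi_0\rangle]\ge\Delta$$ for every Hermitian $\mathcal O$ supported on a connected set $S$ with $\mathrm{diam}\,S\le R$, where $\langle\mathcal O\rangle_{\psi_0}=\langle\psi_0|\mathcal O|\psi_0\rangle/\langle\psi_0|\psi_0\rangle$. Proposition. For every $d$ and $c_d$ there is a constant $c_->0$, depending only on $d$ and $c_d$, such that the following holds for all $N$, all $q\ge 1$, all $d$-dimensional graphs with constant $c_d$ and all real $0<\mu\le 1/(2\mathrm e)$, $h>0$, $\Delta>0$, $R$, and $\epsilon>0$. Let $H=\sum_S H_S$ be Hermitian with $$\max_{i\in\Lambda}\sum_{S\ni i}\mathrm e^{2\mu\,\mathrm{diam}\,S}\|H_S\|\le h .$$ Let $A(s)=\sum_S A_S(s)$, $s\in[0,1]$, be anti-Hermitian with every $A_S(\cdot)$ integrable on $[0,1]$, let $U=\mathcal T\mathrm e^{\int_0^1\mathrm ds\,A(s)}$ be its time-ordered exponential (that is, $U=W(1)$ for the continuous solution of $W(t)=I+\int_0^t A(s)W(s)\,\mathrm ds$), and suppose that $$\max_{s\in[0,1]}\max_{i\in\Lambda}\sum_{S\ni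 i}\mathrm e^{2\mu\,\mathrm{diam}\,S}\|A_S(s)\|\le\frac{\epsilon}{c_-h}(2\mu)^{4d-2}<(2\mu)^{6d+2}$$ and that $\epsilon\le\Delta/(2c_d)$. If $(H,|\mathbf 0\rangle)$ is $(\Delta,R)$-metastable, then $(U^\dagger HU,|\mathbf 0\rangle)$ is $(\Delta/2,R')$-metastable with $$R'=\min\Big(R,\Big(\frac{\Delta}{2c_d\epsilon}\Big)^{1/d}\Big).$$ -/

import Mathlib

noncomputable section

namespace Metastable

/-! ### Geometry of the interaction graph -/

section Graph

variable {V : Type*} [Fintype V] [DecidableEq V]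

/-- A set of sites is connected if any two of its sites are joined by a path inside the set. -/
def ConnectedIn (G : SimpleGraph V) (S : Finset V) : Prop :=
  (G.induce (S : Set V)).Preconnected

/-- The diameter of a set of sites: the largest graph distance (in the whole graph) between two
of its points. It is used only for connected sets, where all these distances are attained by
paths. -/
def diam (G : SimpleGraph V) (S : Finset V) : ℕ :=
  (S ×ˢ S).sup fun p => G.dist p.1 p.2

open Classical in
/-- The boundary of `S`: the sites of `S` at distance one from the complement of `S`. -/
def boundary (G : SimpleGraph V) (S : Finset V) : Finset V :=
  S.filter fun i => ∃ j, j ∉ S ∧ G.Adj i j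

/-- The graph is `d`-dimensional with constant `cd`: every connected set of sites satisfies the
surface bound and the volume bound. -/
def IsDimensional (G : SimpleGraph V) (d : ℕ) (cd : ℝ) : Prop :=
  ∀ S : Finset V, ConnectedIn G S →
    ((boundary G S).card : ℝ) ≤ cd * (max 1 (diam G S : ℝ)) ^ (d - 1) ∧
    (S.card : ℝ) ≤ cd * (max 1 (diam G S : ℝ)) ^ d

end Graph

/-! ### Qudits, local operators, and local norms -/

/-- The Hilbert space of one `q`-level qudit on every site of `V`, in the computational basis. -/
abbrev QState (V : Type*) [Fintype V] (q : ℕ) : Type _ := EuclideanSpace ℂ (V → Fin q)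

/-- Operators on the many-body Hilbert space, with the operator norm. -/
abbrev QOp (V : Type*) [Fintype V] (q : ℕ) : Type _ := QState V q →L[ℂ] QState V q

section Operators

variable {V : Type*} [Fintype V] [DecidableEq V] {q : ℕ}

/-- The computational basis vector labelled by the configuration `x`. -/
def ket (x : V → Fin q) : QState V q := EuclideanSpace.single x 1

/-- The all-zero product state. -/
def zeroState (V : Type*) [Fintype V] [DecidableEq V] (q : ℕ) [NeZero q] : QState V q :=
  ket fun _ => 0

/-- `O` is supported in `S`, that is, `O` is the tensor product of the identity on the complement
of `S` with an operator `M` on the qudits of `S`; written through matrix elements. -/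
def SupportedIn (O : QOp V q) (S : Finset V) : Prop :=
  ∃ M : Matrix (S → Fin q) (S → Fin q) ℂ, ∀ x y : V → Fin q,
    (O (ket y)) x = if ∀ i, i ∉ S → x i = y i then M (fun i => x i) (fun i => y i) else 0

/-- `Os` is a local decomposition of `O`: each term `Os S` is supported in `S`, only connected
sets occur, and the terms add up to `O`. -/
structure IsLocalDecomp (G : SimpleGraph V) (O : QOp V q) (Os : Finset V → QOp V q) : Prop where
  connected : ∀ S, Os S ≠ 0 → ConnectedIn G S
  supported : ∀ S, SupportedIn (Os S) S
  sum_eq : O = ∑ S, Os S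

/-- The exponentially weighted local norm of a decomposition is at most `b`:
`max_i ∑_{S ∋ i} exp (κ diam S) ‖Os S‖ ≤ b`. -/
def LocalNormLE (G : SimpleGraph V) (κ : ℝ) (Os : Finset V → QOp V q) (b : ℝ) : Prop :=
  ∀ i : V, ∑ S : Finset V with i ∈ S, Real.exp (κ * (diam G S : ℝ)) * ‖Os S‖ ≤ b

/-- `U` is the time-ordered exponential of `A` over `[0, 1]`, later times to the left:
`U = W 1`, where `W 0 = 1` and `W' = A W`, the equation being written in integral form so that
`A` may be discontinuous in time. -/
def IsTimeOrderedExp (A : ℝ → QOp V q) (U : QOp V q) : Prop :=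
  ∃ W : ℝ → QOp V q, ContinuousOn W (Set.Icc 0 1) ∧
    (∀ t ∈ Set.Icc (0 : ℝ) 1, W t = 1 + ∫ s in (0 : ℝ)..t, A s * W s) ∧ W 1 = U

/-! ### Metastability -/

/-- The average energy of a possibly unnormalized state, equal to `+∞` for the zero vector. -/
def energy (H : QOp V q) (ψ : QState V q) : EReal :=
  open Classical in
  if ψ = 0 then ⊤ else (((inner ℂ ψ (H ψ)).re / ‖ψ‖ ^ 2 : ℝ) : EReal)

/-- The expectation value of `O` in the state `ψ`. -/
def expect (O : QOp V q) (ψ : QState V q) : ℂ := inner ℂ ψ (O ψ) / inner ℂ ψ ψ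

/-- `(H, ψ₀)` is `(Δ, R)`-metastable: `R ≥ 1`, and every Hermitian operator on a connected set of
diameter at most `R` either stabilizes `ψ₀` or raises the energy by at least `Δ`. -/
def IsMetastable (G : SimpleGraph V) (H : QOp V q) (ψ₀ : QState V q) (Δ R : ℝ) : Prop :=
  1 ≤ R ∧ ∀ S : Finset V, ConnectedIn G S → (diam G S : ℝ) ≤ R →
    ∀ O : QOp V q, IsSelfAdjoint O → SupportedIn O S →
      (Δ : EReal) ≤ energy H (O ψ₀ - expect O ψ₀ • ψ₀) - energy H ψ₀

end Operators

end Metastable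

end

/-! Let W solve W' = AW. The Heisenberg equation gives U†HU − H = ∫ Y(s) ds with Y(s) = W(s)†[H,
A(s)]W(s). This operator is extensive, so its norm is useless. It is measured instead by δ, the
supremum of ‖[Y, g]‖ over all sign and permutation gates g at single sites.

Only scalars on a site commute with all gates there. Averaging Y over the gates at the sites of S,
one site after another, therefore produces an operator supported off S within 2|S|δ of Y
(`exists_supportedIn_compl`). There are two consequences. A vector of the form (anything on S) ⊗ |0⟩
off S has the same normalized expectation of Y as the zero state, up to 4|S|δ
(`abs_expectation_sub_le`). And ‖[Y, O]‖ ≤ 4|S|δ‖O‖ for O localized in S (`norm_lie_le_of_gates`).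

The second consequence lets a Gronwall argument close on δ alone. Differentiating the commutator of
the evolved operator with g brings in [g, A], a sum of local terms touching one site, and these are
again controlled by δ (`IsPropagator.norm_lie_evolution_le`). No light cone or spatial decay
estimate is needed. At the start, [H, A] has δ of order h a / κ^d, where κ = 2μ, a is the local norm
of A, and κ^(-d) is the price of absorbing |S| into the exponential weight.

Thus the excess energy of an excitation on S drops by at most |S|ε, which the volume bound makes at
most Δ/2 when diam S ≤ R'. -/

noncomputable section

namespace Metastable

/-! ### Matrix entries, disjoint supports, local excitations of the zero state -/

section Entries

variable {V : Type*} [Fintype V] [DecidableEq V] {q : ℕ}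

/-- The matrix entry of an operator between two configurations. -/
def entry (O : QOp V q) (x y : V → Fin q) : ℂ := (O (ket y)) x

lemma apply_eq_sum_entry (O : QOp V q) (ψ : QState V q) (x : V → Fin q) :
    (O ψ) x = ∑ y, entry O x y * ψ y := by
  have h : ψ = ∑ y, ψ y • ket y := by
    ext z
    simp [ket, Pi.single_apply]
  conv_lhs => rw [h]
  simp [entry, map_sum, mul_comm]

lemma entry_mul (O K : QOp V q) (x y : V → Fin q) :
    entry (O * K) x y = ∑ z, entry O x z * entry K z y :=
  apply_eq_sum_entry O (K (ket y)) x

lemma entry_ext {O K : QOp V q} (h : ∀ x y, entry O x y = entry K x y) : O = K := by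
  ext ψ x
  simp [apply_eq_sum_entry, h]

lemma inner_eq_sum_entry (O : QOp V q) (φ ψ : QState V q) :
    inner ℂ φ (O ψ) = ∑ x, ∑ y, (starRingEnd ℂ) (φ x) * entry O x y * ψ y := by
  simp only [PiLp.inner_apply, RCLike.inner_apply, apply_eq_sum_entry, Finset.sum_mul]
  refine Finset.sum_congr rfl fun x _ => Finset.sum_congr rfl fun y _ => by ring

/-- Operators with disjoint supports commute. -/
lemma SupportedIn.commute {O K : QOp V q} {S T : Finset V} (hO : SupportedIn O S)
    (hK : SupportedIn K T) (hST : Disjoint S T) : Commute O K := by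
  obtain ⟨M, hM⟩ := hO
  obtain ⟨M', hM'⟩ := hK
  have hd : ∀ i, i ∈ S → i ∉ T := fun i h h' => Finset.disjoint_left.mp hST h h'
  refine entry_ext fun x y => ?_
  -- Only one intermediate configuration contributes to each product: for O K it must equal x off S
  -- and y on S, since K leaves the sites of S alone. For K O the same holds with T.
  rw [entry_mul, entry_mul, Finset.sum_eq_single (S.piecewise y x),
    Finset.sum_eq_single (T.piecewise y x)]
  · simp only [entry, hM, hM']
    have e1 : (∀ i, i ∉ S → x i = S.piecewise y x i) := fun i hi => by simp [hi]
    have e2 : (∀ i, i ∉ T → x i = T.piecewise y x i) := fun i hi => by simp [hi]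
    have e3 : (∀ i, i ∉ T → S.piecewise y x i = y i) ↔ (∀ i, i ∉ S → i ∉ T → x i = y i) := by
      refine ⟨fun h i hS hT => by simpa [hS] using h i hT, fun h i hT => ?_⟩
      by_cases hS : i ∈ S <;> simp [hS, h i, hT]
    have e4 : (∀ i, i ∉ S → T.piecewise y x i = y i) ↔ (∀ i, i ∉ S → i ∉ T → x i = y i) := by
      refine ⟨fun h i hS hT => by simpa [hT] using h i hS, fun h i hS => ?_⟩
      by_cases hT : i ∈ T <;> simp [hS, h i, hT]
    rw [if_pos e1, if_pos e2]
    simp only [e3, e4]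
    split_ifs with h
    · rw [mul_comm]
      congr 2
      · ext i
        have : (i : V) ∉ S := fun h => hd _ h i.2
        simp [this]
      · ext i
        simp
      · ext i
        simp [hd _ i.2]
      · ext i
        simp
    · simp
  · intro z _ hz
    by_contra hne
    simp only [entry, hM, hM', mul_eq_zero, not_or, ite_eq_right_iff, not_forall] at hne
    obtain ⟨⟨h1, _⟩, h2, _⟩ := hne
    refine hz (funext fun i => ?_)
    by_cases hi : i ∈ T
    · simp [hi, h2 i fun h => hd i h hi]
    · simp [hi, h1 i hi]
  · simp
  · intro z _ hz
    by_contra hne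
    simp only [entry, hM, hM', mul_eq_zero, not_or, ite_eq_right_iff, not_forall] at hne
    obtain ⟨⟨h1, _⟩, h2, _⟩ := hne
    refine hz (funext fun i => ?_)
    by_cases hi : i ∈ S
    · simp [hi, h2 i (hd i hi)]
    · simp [hi, h1 i hi]
  · simp

/-- A vector that is a product of the zero state outside `S` with any vector on `S` gives the same
expectation to operators supported off `S` as the zero state. -/
lemma inner_apply_of_supportedIn_compl [NeZero q] {K : QOp V q} {S : Finset V}
    (hK : SupportedIn K Sᶜ) {φ : QState V q} (hφ : ∀ x, φ x ≠ 0 → ∀ i, i ∉ S → x i = 0) :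
    inner ℂ φ (K φ) = inner ℂ (zeroState V q) (K (zeroState V q)) * (‖φ‖ : ℂ) ^ 2 := by
  obtain ⟨M, hM⟩ := hK
  have h0 : inner ℂ (zeroState V q) (K (zeroState V q)) = M (fun _ => 0) (fun _ => 0) := by
    have : inner ℂ (zeroState V q) (K (zeroState V q)) = (K (ket fun _ => 0)) (fun _ => 0) := by
      simp [zeroState, ket, EuclideanSpace.inner_single_left]
    rw [this, hM]
    simp
  rw [h0, inner_eq_sum_entry]
  have h1 : ((‖φ‖ : ℂ)) ^ 2 = ∑ x, (starRingEnd ℂ) (φ x) * φ x := by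
    rw [← Complex.ofReal_pow, EuclideanSpace.norm_sq_eq]
    push_cast
    exact Finset.sum_congr rfl fun x _ => (Complex.conj_mul' _).symm
  rw [h1, Finset.mul_sum]
  refine Finset.sum_congr rfl fun x _ => ?_
  rw [Finset.sum_eq_single x]
  · by_cases hx : φ x = 0
    · simp [hx]
    · have : (fun i : (Sᶜ : Finset V) => x i) = fun _ => 0 :=
        funext fun i => hφ x hx i (Finset.mem_compl.mp i.2)
      simp only [entry, hM, this]
      simp
      ring
  · intro y _ hy
    by_contra hne
    simp only [mul_eq_zero, not_or, entry, hM, ite_eq_right_iff, not_forall, map_eq_zero] at hne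
    obtain ⟨⟨hx, h, -⟩, hy'⟩ := hne
    refine hy (funext fun i => ?_)
    by_cases hi : i ∈ S
    · exact (h i (by simpa using hi)).symm
    · rw [hφ x hx i hi, hφ y hy' i hi]
  · simp

/-- Neither O nor the identity can move the zero state off S. This is the only property of an
excitation that the stability argument uses. -/
lemma SupportedIn.apply_zeroState_eq_zero [NeZero q] {O : QOp V q} {S : Finset V}
    (hO : SupportedIn O S) (c : ℂ) (x : V → Fin q)
    (hx : (O (zeroState V q) - c • zeroState V q) x ≠ 0) : ∀ i, i ∉ S → x i = 0 := by
  obtain ⟨M, hM⟩ := hO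
  by_contra hne
  apply hx
  have hx0 : x ≠ fun _ => 0 := by
    rintro rfl
    exact hne fun _ _ => rfl
  have h1 := hM x fun _ => 0
  rw [if_neg hne] at h1
  simp [zeroState, h1]
  simp [ket, hx0]

end Entries

/-! ### Averages over finite groups of single-site gates -/

section Averaging

variable {V : Type*} [Fintype V] [DecidableEq V] {q : ℕ}

lemma norm_lie_le {R : Type*} [NormedRing R] (a b : R) : ‖⁅a, b⁆‖ ≤ 2 * ‖a‖ * ‖b‖ := by
  rw [Ring.lie_def]
  calc ‖a * b - b * a‖ ≤ ‖a * b‖ + ‖b * a‖ := norm_sub_le _ _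
    _ ≤ ‖a‖ * ‖b‖ + ‖b‖ * ‖a‖ := add_le_add (norm_mul_le _ _) (norm_mul_le _ _)
    _ = 2 * ‖a‖ * ‖b‖ := by ring

/-- The average of the conjugates of `Y` under a representation of a finite group. -/
def conjAverage {G : Type*} [Group G] [Fintype G] (ρ : G →* QOp V q) (Y : QOp V q) : QOp V q :=
  (Fintype.card G : ℂ)⁻¹ • ∑ g, ρ g * Y * ρ g⁻¹

section ConjAverage

variable {G : Type*} [Group G] [Fintype G] (ρ : G →* QOp V q)

lemma norm_average_le {f : G → QOp V q} {b : ℝ} (hf : ∀ g, ‖f g‖ ≤ b) :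
    ‖(Fintype.card G : ℂ)⁻¹ • ∑ g, f g‖ ≤ b := by
  have hc : (0 : ℝ) < Fintype.card G := by exact_mod_cast Fintype.card_pos
  rw [norm_smul, norm_inv, Complex.norm_natCast, inv_mul_le_iff₀ hc]
  calc ‖∑ g, f g‖ ≤ ∑ _g : G, b := norm_sum_le_of_le _ fun g _ => hf g
    _ = _ := by simp

lemma conjAverage_sub (Y Z : QOp V q) :
    conjAverage ρ (Y - Z) = conjAverage ρ Y - conjAverage ρ Z := by
  simp only [conjAverage, mul_sub, sub_mul, Finset.sum_sub_distrib, smul_sub]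

lemma norm_conjAverage_le (hρ : ∀ g, ‖ρ g‖ ≤ 1) (Y : QOp V q) : ‖conjAverage ρ Y‖ ≤ ‖Y‖ := by
  refine norm_average_le fun g => ?_
  calc ‖ρ g * Y * ρ g⁻¹‖ ≤ ‖ρ g‖ * ‖Y‖ * ‖ρ g⁻¹‖ :=
        (norm_mul_le _ _).trans (mul_le_mul_of_nonneg_right (norm_mul_le _ _) (norm_nonneg _))
    _ ≤ 1 * ‖Y‖ * 1 := by gcongr <;> exact hρ _
    _ = ‖Y‖ := by ring

/-- Each summand satisfies Y − ρ(g) Y ρ(g)⁻¹ = [Y, ρ(g)] ρ(g)⁻¹. -/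
lemma norm_sub_conjAverage_le (hρ : ∀ g, ‖ρ g‖ ≤ 1) {Y : QOp V q} {δ : ℝ}
    (hY : ∀ g, ‖⁅Y, ρ g⁆‖ ≤ δ) : ‖Y - conjAverage ρ Y‖ ≤ δ := by
  have hc : (Fintype.card G : ℂ) ≠ 0 := by exact_mod_cast Fintype.card_ne_zero
  have h : Y - conjAverage ρ Y = (Fintype.card G : ℂ)⁻¹ • ∑ g, ⁅Y, ρ g⁆ * ρ g⁻¹ := by
    have h1 : ∀ g, ⁅Y, ρ g⁆ * ρ g⁻¹ = Y - ρ g * Y * ρ g⁻¹ := fun g => by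
      rw [Ring.lie_def, sub_mul, mul_assoc Y, ← map_mul, mul_inv_cancel, map_one, mul_one]
    simp only [h1, Finset.sum_sub_distrib, smul_sub, conjAverage]
    congr 1
    rw [Finset.sum_const, Finset.card_univ, ← Nat.cast_smul_eq_nsmul ℂ, smul_smul,
      inv_mul_cancel₀ hc, one_smul]
  rw [h]
  refine norm_average_le fun g => ?_
  calc ‖⁅Y, ρ g⁆ * ρ g⁻¹‖ ≤ ‖⁅Y, ρ g⁆‖ * ‖ρ g⁻¹‖ := norm_mul_le _ _
    _ ≤ ‖⁅Y, ρ g⁆‖ * 1 := by gcongr; exact hρ _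
    _ ≤ δ := by rw [mul_one]; exact hY g

lemma commute_conjAverage_self (Y : QOp V q) (h : G) : Commute (conjAverage ρ Y) (ρ h) := by
  refine Commute.smul_left ?_ _
  change (∑ g, ρ g * Y * ρ g⁻¹) * ρ h = ρ h * ∑ g, ρ g * Y * ρ g⁻¹
  rw [Finset.sum_mul, Finset.mul_sum]
  refine Fintype.sum_equiv (Equiv.mulLeft h⁻¹) _ _ fun g => ?_
  simp only [Equiv.coe_mulLeft, ← mul_assoc, ← map_mul, mul_inv_rev, inv_inv, mul_inv_cancel,
    one_mul]
  rw [mul_assoc, ← map_mul]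

/-- `T'` plays the role of ρ(g)⁻¹ T ρ(g): it suffices that Y commutes with every conjugate of T. -/
lemma commute_conjAverage {Y T : QOp V q}
    (h : ∀ g, ∃ T', ρ g * T' = T * ρ g ∧ T' * ρ g⁻¹ = ρ g⁻¹ * T ∧ Commute Y T') :
    Commute (conjAverage ρ Y) T := by
  refine Commute.smul_left ?_ _
  refine Commute.sum_left _ _ _ fun g _ => ?_
  obtain ⟨T', h1, h2, h3⟩ := h g
  calc ρ g * Y * ρ g⁻¹ * T = ρ g * (Y * T') * ρ g⁻¹ := by rw [mul_assoc, ← h2]; noncomm_ring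
    _ = T * (ρ g * Y * ρ g⁻¹) := by rw [h3.eq, ← mul_assoc, h1]; noncomm_ring

end ConjAverage

/-- The permutation `σ` of the local basis at the site `j`. -/
def sitePerm (j : V) : Equiv.Perm (Fin q) →* QOp V q where
  toFun σ := LinearMap.toContinuousLinearMap
    { toFun := fun ψ => WithLp.toLp 2 fun x => ψ (Function.update x j (σ⁻¹ (x j)))
      map_add' := fun _ _ => rfl
      map_smul' := fun _ _ => rfl }
  map_one' := by ext ψ x; simp [Equiv.Perm.one_def]
  map_mul' σ τ := by ext ψ x; simp [Equiv.Perm.mul_def]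

/-- The diagonal sign operator at the site `j`. -/
def siteSign (j : V) : (Fin q → ℤˣ) →* QOp V q where
  toFun s := LinearMap.toContinuousLinearMap
    { toFun := fun ψ => WithLp.toLp 2 fun x => ((s (x j) : ℤ) : ℂ) * ψ x
      map_add' := fun _ _ => by ext x; simp [mul_add]
      map_smul' := fun _ _ => by ext x; simp; ring }
  map_one' := by ext ψ x; simp
  map_mul' s t := by ext ψ x; simp; ring

@[simp] lemma sitePerm_apply (j : V) (σ : Equiv.Perm (Fin q)) (ψ : QState V q) (x : V → Fin q) :
    (sitePerm j σ ψ) x = ψ (Function.update x j (σ⁻¹ (x j))) := rfl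

@[simp] lemma siteSign_apply (j : V) (s : Fin q → ℤˣ) (ψ : QState V q) (x : V → Fin q) :
    (siteSign j s ψ) x = ((s (x j) : ℤ) : ℂ) * ψ x := rfl

lemma norm_sitePerm_le (j : V) (σ : Equiv.Perm (Fin q)) : ‖sitePerm j σ‖ ≤ 1 := by
  refine ContinuousLinearMap.opNorm_le_bound _ zero_le_one fun ψ => ?_
  rw [one_mul, EuclideanSpace.norm_eq, EuclideanSpace.norm_eq]
  refine le_of_eq (congrArg _ ?_)
  let e : Equiv.Perm (V → Fin q) :=
    { toFun := fun x => Function.update x j (σ⁻¹ (x j))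
      invFun := fun x => Function.update x j (σ (x j))
      left_inv := fun x => by simp
      right_inv := fun x => by simp }
  exact Fintype.sum_equiv e _ _ fun x => rfl

lemma norm_siteSign_le (j : V) (s : Fin q → ℤˣ) : ‖siteSign j s‖ ≤ 1 := by
  refine ContinuousLinearMap.opNorm_le_bound _ zero_le_one fun ψ => ?_
  rw [one_mul, EuclideanSpace.norm_eq, EuclideanSpace.norm_eq]
  refine le_of_eq (congrArg _ (Finset.sum_congr rfl fun x _ => ?_))
  rw [siteSign_apply]
  rcases Int.units_eq_one_or (s (x j)) with h | h <;> simp [h]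

/-- Labels of the gates at one site. -/
abbrev Gate (q : ℕ) : Type := (Fin q → ℤˣ) ⊕ Equiv.Perm (Fin q)

/-- A finite irreducible family of unitary gates at one site: signs and permutations of the local
basis. -/
def siteGate (j : V) : Gate q → QOp V q :=
  Sum.elim (siteSign j) (sitePerm j)

lemma norm_siteGate_le (j : V) (g : Gate q) : ‖siteGate j g‖ ≤ 1 := by
  rcases g with s | σ
  exacts [norm_siteSign_le j s, norm_sitePerm_le j σ]

lemma supportedIn_siteGate (j : V) (g : Gate q) :
    SupportedIn (siteGate j g) {j} := by
  rcases g with s | σ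
  · refine ⟨fun a b => if a ⟨j, by simp⟩ = b ⟨j, by simp⟩ then ((s (a ⟨j, by simp⟩) : ℤ) : ℂ) else 0,
      fun x y => ?_⟩
    simp only [siteGate, Sum.elim_inl, siteSign_apply, ket, EuclideanSpace.single]
    by_cases h : x = y
    · simp [h]
    · have : ¬ ((∀ i, i ∉ ({j} : Finset V) → x i = y i) ∧ x j = y j) := fun h' =>
        h (funext fun i => by
          by_cases hi : i = j
          · exact hi ▸ h'.2
          · exact h'.1 i (by simpa using hi))
      rw [← ite_and, if_neg this]
      simp [h]
  · refine ⟨fun a b => if a ⟨j, by simp⟩ = σ (b ⟨j, by simp⟩) then 1 else 0, fun x y => ?_⟩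
    rw [← ite_and]
    simp only [siteGate, Sum.elim_inr, sitePerm_apply, ket, PiLp.single_apply]
    congr 1
    rw [eq_iff_iff, Function.update_eq_iff]
    simp only [Finset.mem_singleton, Equiv.Perm.inv_eq_iff_eq]
    tauto

/-- The average over the signs and the permutations at the site `j`. -/
def siteAverage (j : V) (Y : QOp V q) : QOp V q :=
  conjAverage (sitePerm j) (conjAverage (siteSign j) Y)

end Averaging

/-! ### Approximation by operators supported off a set -/

section LocalApproximation

variable {V : Type*} [Fintype V] [DecidableEq V] {q : ℕ}

lemma norm_siteAverage_le (j : V) (Y : QOp V q) : ‖siteAverage j Y‖ ≤ ‖Y‖ :=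
  (norm_conjAverage_le _ (norm_sitePerm_le j) _).trans
    (norm_conjAverage_le _ (norm_siteSign_le j) _)

lemma siteAverage_sub (j : V) (Y Z : QOp V q) :
    siteAverage j (Y - Z) = siteAverage j Y - siteAverage j Z := by
  simp only [siteAverage, conjAverage_sub]

/-- With P and D the permutation and sign averages, Y − PDY = (Y − PY) + P(Y − DY), and P is a
contraction. So only commutators of Y itself enter, and each average costs δ. -/
lemma norm_sub_siteAverage_le (j : V) {Y : QOp V q} {δ : ℝ}
    (hY : ∀ g : Gate q, ‖⁅Y, siteGate j g⁆‖ ≤ δ) : ‖Y - siteAverage j Y‖ ≤ 2 * δ := by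
  have h1 := norm_sub_conjAverage_le (sitePerm j) (norm_sitePerm_le j) fun σ => hY (Sum.inr σ)
  have h2 := norm_sub_conjAverage_le (siteSign j) (norm_siteSign_le j) fun s => hY (Sum.inl s)
  have h3 := norm_conjAverage_le (sitePerm j) (norm_sitePerm_le j)
    (Y - conjAverage (siteSign j) Y)
  rw [conjAverage_sub] at h3
  have h4 := norm_sub_le_norm_sub_add_norm_sub Y (conjAverage (sitePerm j) Y) (siteAverage j Y)
  simp only [siteAverage] at h4 ⊢
  linarith

/-- Permutations normalize the group of signs, turning the pattern s into s ∘ σ. The outer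
permutation average therefore keeps the commutation with signs gained by the inner one. -/
lemma commute_siteAverage_self (j : V) (Y : QOp V q) (g : Gate q) :
    Commute (siteAverage j Y) (siteGate j g) := by
  rcases g with s | σ
  · refine commute_conjAverage _ fun σ => ⟨siteSign j (s ∘ σ), ?_, ?_,
      commute_conjAverage_self _ _ _⟩
    · ext ψ x
      simp [siteGate]
    · ext ψ x
      simp [siteGate, Equiv.Perm.inv_def]
  · exact commute_conjAverage_self _ _ _

lemma commute_siteAverage (j : V) {Y T : QOp V q} (hY : Commute Y T)
    (hT : ∀ g, Commute (siteGate j g) T) : Commute (siteAverage j Y) T :=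
  commute_conjAverage _ fun σ => ⟨T, hT (Sum.inr σ), (hT (Sum.inr σ⁻¹)).symm,
    commute_conjAverage _ fun s => ⟨T, hT (Sum.inl s), (hT (Sum.inl s⁻¹)).symm, hY⟩⟩

/-- An operator that commutes with the gates at all sites of `S` is supported off `S`. -/
lemma supportedIn_compl_of_commute [NeZero q] {K : QOp V q} {S : Finset V}
    (hK : ∀ j ∈ S, ∀ g : Gate q, Commute K (siteGate j g)) : SupportedIn K Sᶜ := by
  have hoff : ∀ x y : V → Fin q, ∀ j ∈ S, x j ≠ y j → entry K x y = 0 := by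
    intro x y j hj hxy
    -- Flipping the sign of the label `x j` alone fixes `ket y` and negates row x, which forces the
    -- entry to equal its own negative.
    let s : Fin q → ℤˣ := fun c => if c = x j then -1 else 1
    have hs : siteSign j s (ket y) = ket y := by
      ext z
      rw [siteSign_apply]
      by_cases hz : z = y
      · simp [hz, s, hxy.symm]
      · simp [ket, hz]
    have h := congrArg (fun O : QOp V q => entry O x y) (hK j hj (Sum.inl s)).eq
    simp only [entry, siteGate, Sum.elim_inl, mul_apply_eq_comp, siteSign_apply, hs]
      at h
    simp only [s, if_true] at h
    simp only [Units.val_neg, Units.val_one, Int.cast_neg, Int.cast_one, neg_mul, one_mul] at h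
    exact self_eq_neg.mp h
  have hperm : ∀ x y : V → Fin q, ∀ j ∈ S, ∀ σ : Equiv.Perm (Fin q),
      entry K (Function.update x j (σ (x j))) (Function.update y j (σ (y j))) = entry K x y := by
    intro x y j hj σ
    have hs : sitePerm j σ (ket y) = ket (Function.update y j (σ (y j))) := by
      ext z
      simp only [sitePerm_apply, ket, PiLp.single_apply]
      congr 1
      rw [eq_iff_iff, Function.update_eq_iff, Function.eq_update_iff, Equiv.Perm.inv_eq_iff_eq]
    have h := congrArg (fun O : QOp V q => entry O (Function.update x j (σ (x j))) y)
      (hK j hj (Sum.inr σ)).eq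
    simp only [entry, siteGate, Sum.elim_inr, mul_apply_eq_comp, hs, sitePerm_apply]
      at h
    simpa [entry] using h
  have hzero : ∀ T ⊆ S, ∀ x y : V → Fin q, (∀ i ∈ S, x i = y i) →
      entry K x y = entry K (T.piecewise 0 x) (T.piecewise 0 y) := by
    intro T
    induction T using Finset.induction_on with
    | empty => simp
    | insert j T hj ih =>
      intro hT x y hxy
      have hjS : j ∈ S := hT (Finset.mem_insert_self _ _)
      rw [ih ((Finset.subset_insert _ _).trans hT) x y hxy,
        ← hperm _ _ j hjS (Equiv.swap (x j) 0), Finset.piecewise_insert, Finset.piecewise_insert]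
      simp [hj, hxy j hjS]
  refine ⟨fun a b => entry K (fun i => if h : i ∈ Sᶜ then a ⟨i, h⟩ else 0)
    (fun i => if h : i ∈ Sᶜ then b ⟨i, h⟩ else 0), fun x y => ?_⟩
  split_ifs with h
  · have := hzero S subset_rfl x y fun i hi => h i (by simpa using hi)
    change entry K x y = _
    rw [this]
    congr 1 <;> ext i <;> by_cases hi : i ∈ S <;> simp [hi]
  · push Not at h
    obtain ⟨j, hj, hxy⟩ := h
    exact hoff x y j (by simpa using hj) hxy

/-- An operator that almost commutes with all gates at the sites of `S` is close to an operator
supported off `S`. -/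
theorem exists_supportedIn_compl [NeZero q] (Y : QOp V q) (S : Finset V) {δ : ℝ}
    (hY : ∀ j ∈ S, ∀ g : Gate q, ‖⁅Y, siteGate j g⁆‖ ≤ δ) :
    ∃ Y', SupportedIn Y' Sᶜ ∧ ‖Y - Y'‖ ≤ 2 * S.card * δ := by
  suffices h : ∃ Y', (∀ j ∈ S, ∀ g : Gate q, Commute Y' (siteGate j g)) ∧ ‖Y - Y'‖ ≤ 2 * S.card * δ by
    obtain ⟨Y', h1, h2⟩ := h
    exact ⟨Y', supportedIn_compl_of_commute h1, h2⟩
  induction S using Finset.induction_on with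
  | empty => exact ⟨Y, by simp⟩
  | insert j S hj ih =>
    obtain ⟨Y', h1, h2⟩ := ih fun i hi => hY i (Finset.mem_insert_of_mem hi)
    -- The error is split at `siteAverage j Y`, not at `Y'`: the new site costs 2δ through
    -- commutators of the original Y, and averaging contracts the old error. Errors thus add up
    -- linearly.
    refine ⟨siteAverage j Y', fun i hi g => ?_, ?_⟩
    · rcases Finset.mem_insert.mp hi with rfl | hi
      · exact commute_siteAverage_self _ _ _
      · refine commute_siteAverage j (h1 i hi g) fun g' =>
          (supportedIn_siteGate j g').commute (supportedIn_siteGate i g) ?_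
        rw [Finset.disjoint_singleton]
        rintro rfl
        exact hj hi
    · have h3 := norm_sub_siteAverage_le j (hY j (Finset.mem_insert_self _ _))
      have h4 := norm_siteAverage_le j (Y - Y')
      rw [siteAverage_sub] at h4
      have h5 := norm_sub_le_norm_sub_add_norm_sub Y (siteAverage j Y) (siteAverage j Y')
      rw [Finset.card_insert_of_notMem hj]
      push_cast
      linarith

/-- `O` commutes with all operators supported off `S`. -/
def CommutesOff (O : QOp V q) (S : Finset V) : Prop :=
  ∀ (K : QOp V q) (T : Finset V), Disjoint T S → SupportedIn K T → Commute K O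

lemma SupportedIn.commutesOff {O : QOp V q} {S : Finset V} (hO : SupportedIn O S) :
    CommutesOff O S := fun _ _ hT hK => hK.commute hO hT

/-- Localization expressed through a commutant passes to brackets at once, with no matrix on S to
exhibit. -/
lemma CommutesOff.lie {O P : QOp V q} {S : Finset V} (hO : CommutesOff O S)
    (hP : CommutesOff P S) : CommutesOff ⁅O, P⁆ S := fun K T hT hK => by
  have h1 := hO K T hT hK
  have h2 := hP K T hT hK
  exact (h1.mul_right h2).sub_right (h2.mul_right h1)

/-- The commutator with an operator localized in `S` is controlled by the commutators with the
gates at the sites of `S`. -/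
lemma norm_lie_le_of_gates [NeZero q] {Y O : QOp V q} {S : Finset V} {δ : ℝ}
    (hY : ∀ j ∈ S, ∀ g : Gate q, ‖⁅Y, siteGate j g⁆‖ ≤ δ)
    (hO : CommutesOff O S) :
    ‖⁅Y, O⁆‖ ≤ 4 * S.card * δ * ‖O‖ := by
  obtain ⟨Y', h1, h2⟩ := exists_supportedIn_compl Y S hY
  have h3 : ⁅Y, O⁆ = ⁅Y - Y', O⁆ := by
    rw [Ring.lie_def, Ring.lie_def, sub_mul, mul_sub, (hO Y' _ disjoint_compl_left h1).eq]
    abel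
  rw [h3]
  refine (norm_lie_le _ _).trans ?_
  have := mul_le_mul_of_nonneg_right h2 (norm_nonneg O)
  linarith

/-- A vector agreeing with the zero state off `S` and the zero state itself give nearly the same
expectation to an operator that almost commutes with all gates at the sites of `S`. -/
lemma abs_expectation_sub_le [NeZero q] {Y : QOp V q} {S : Finset V} {δ : ℝ}
    (hY : ∀ j ∈ S, ∀ g : Gate q, ‖⁅Y, siteGate j g⁆‖ ≤ δ) {φ : QState V q} (hφ0 : φ ≠ 0)
    (hφ : ∀ x, φ x ≠ 0 → ∀ i, i ∉ S → x i = 0) :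
    ‖inner ℂ φ (Y φ) / (‖φ‖ : ℂ) ^ 2 - inner ℂ (zeroState V q) (Y (zeroState V q))‖
      ≤ 4 * S.card * δ := by
  obtain ⟨Y', h1, h2⟩ := exists_supportedIn_compl Y S hY
  have hn : (‖φ‖ : ℂ) ^ 2 ≠ 0 := by simpa using hφ0
  have hz : ‖zeroState V q‖ = 1 := by simp [zeroState, ket]
  have e : inner ℂ φ (Y φ) / (‖φ‖ : ℂ) ^ 2 - inner ℂ (zeroState V q) (Y (zeroState V q))
      = inner ℂ φ ((Y - Y') φ) / (‖φ‖ : ℂ) ^ 2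
        - inner ℂ (zeroState V q) ((Y - Y') (zeroState V q)) := by
    have h := inner_apply_of_supportedIn_compl h1 hφ
    simp only [sub_apply, inner_sub_right, h]
    rw [sub_div, mul_div_cancel_right₀ _ hn]
    ring
  have b : ∀ ψ : QState V q, ‖inner ℂ ψ ((Y - Y') ψ)‖ ≤ ‖Y - Y'‖ * ‖ψ‖ ^ 2 := fun ψ => by
    calc ‖inner ℂ ψ ((Y - Y') ψ)‖ ≤ ‖ψ‖ * ‖(Y - Y') ψ‖ := norm_inner_le_norm _ _
      _ ≤ ‖ψ‖ * (‖Y - Y'‖ * ‖ψ‖) := by gcongr; exact ContinuousLinearMap.le_opNorm _ _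
      _ = _ := by ring
  have b1 : ‖inner ℂ φ ((Y - Y') φ) / (‖φ‖ : ℂ) ^ 2‖ ≤ ‖Y - Y'‖ := by
    rw [norm_div, norm_pow, Complex.norm_real, norm_norm]
    exact div_le_of_le_mul₀ (by positivity) (norm_nonneg _) (b φ)
  have b2 := b (zeroState V q)
  rw [hz, one_pow, mul_one] at b2
  rw [e]
  refine (norm_sub_le _ _).trans ?_
  linarith

end LocalApproximation

/-! ### Product rule for primitives of integrable functions -/

section ProductRule

open MeasureTheory Set Filter

variable {R : Type*} [NormedRing R]

lemma AbsolutelyContinuousOnInterval.ring_mul {f g : ℝ → R} {a b : ℝ}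
    (hf : AbsolutelyContinuousOnInterval f a b) (hg : AbsolutelyContinuousOnInterval g a b) :
    AbsolutelyContinuousOnInterval (fun t => f t * g t) a b := by
  obtain ⟨C, hC⟩ := hf.exists_bound
  obtain ⟨D, hD⟩ := hg.exists_bound
  unfold AbsolutelyContinuousOnInterval at hf hg
  refine squeeze_zero' (Eventually.of_forall fun t => Finset.sum_nonneg fun i _ => dist_nonneg) ?_
    (by simpa using (hg.const_mul C).add (hf.const_mul D))
  filter_upwards [mem_inf_of_right (mem_principal_self _)] with t ht
  rw [Finset.mul_sum, Finset.mul_sum, ← Finset.sum_add_distrib]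
  refine Finset.sum_le_sum fun i hi => ?_
  obtain ⟨h1, h2⟩ := ht.1 i hi
  rw [dist_eq_norm, dist_eq_norm, dist_eq_norm]
  have e : f (t.2 i).1 * g (t.2 i).1 - f (t.2 i).2 * g (t.2 i).2
      = f (t.2 i).1 * (g (t.2 i).1 - g (t.2 i).2) + (f (t.2 i).1 - f (t.2 i).2) * g (t.2 i).2 := by
    noncomm_ring
  rw [e]
  refine (norm_add_le _ _).trans (add_le_add ?_ ?_)
  · exact (norm_mul_le _ _).trans (mul_le_mul_of_nonneg_right (hC _ h1) (norm_nonneg _))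
  · refine (norm_mul_le _ _).trans ?_
    rw [mul_comm]
    exact mul_le_mul_of_nonneg_right (hD _ h2) (norm_nonneg _)

lemma intervalIntegrable_sub_Icc {f : ℝ → R} (hf : IntervalIntegrable f volume 0 1) {r t : ℝ}
    (hr : r ∈ Icc (0 : ℝ) 1) (ht : t ∈ Icc (0 : ℝ) 1) : IntervalIntegrable f volume r t :=
  hf.mono_set (by
    rw [uIcc_of_le (zero_le_one' ℝ)]
    exact uIcc_subset_Icc hr ht)

lemma absolutelyContinuousOnInterval_congr {f g : ℝ → R} {a b : ℝ}
    (hf : AbsolutelyContinuousOnInterval f a b) (h : ∀ t ∈ uIcc a b, g t = f t) :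
    AbsolutelyContinuousOnInterval g a b := by
  unfold AbsolutelyContinuousOnInterval at *
  refine hf.congr' ?_
  filter_upwards [mem_inf_of_right (mem_principal_self _)] with t ht
  refine Finset.sum_congr rfl fun i hi => ?_
  obtain ⟨h1, h2⟩ := ht.1 i hi
  rw [h _ h1, h _ h2]

lemma intervalIntegrable_of_eq_sum {ι : Type*} [Fintype ι] {f : ℝ → ι → R} {g : ℝ → R}
    (hf : ∀ i, IntervalIntegrable (fun t => f t i) volume 0 1)
    (hg : ∀ t ∈ Icc (0 : ℝ) 1, g t = ∑ i, f t i) : IntervalIntegrable g volume 0 1 := by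
  refine (IntervalIntegrable.sum Finset.univ fun i _ => hf i).congr fun t ht => ?_
  rw [uIoc_of_le zero_le_one] at ht
  rw [hg t (Ioc_subset_Icc_self ht), Finset.sum_apply]

variable [NormedAlgebra ℝ R]

/-- Increments are dominated by those of the real primitive of ‖f‖. -/
lemma absolutelyContinuousOnInterval_integral {f : ℝ → R} (hf : IntervalIntegrable f volume 0 1) :
    AbsolutelyContinuousOnInterval (fun t => ∫ s in (0 : ℝ)..t, f s) 0 1 := by
  have h := hf.norm.absolutelyContinuousOnInterval_intervalIntegral (c := 0) (by simp)
  have h0 : (0 : ℝ) ∈ Icc (0 : ℝ) 1 := by simp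
  unfold AbsolutelyContinuousOnInterval at *
  refine squeeze_zero' (Eventually.of_forall fun t => Finset.sum_nonneg fun i _ => dist_nonneg) ?_ h
  filter_upwards [mem_inf_of_right (mem_principal_self _)] with t ht
  refine Finset.sum_le_sum fun i hi => ?_
  obtain ⟨h1, h2⟩ := ht.1 i hi
  rw [uIcc_of_le (zero_le_one' ℝ)] at h1 h2
  rw [dist_eq_norm, dist_eq_norm,
    intervalIntegral.integral_interval_sub_left (intervalIntegrable_sub_Icc hf h0 h1)
      (intervalIntegrable_sub_Icc hf h0 h2),
    intervalIntegral.integral_interval_sub_left (intervalIntegrable_sub_Icc hf.norm h0 h1)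
      (intervalIntegrable_sub_Icc hf.norm h0 h2), Real.norm_eq_abs]
  exact intervalIntegral.norm_integral_le_abs_integral_norm

/-- `f` is the primitive of the integrable function `f'` on `[0, 1]`. -/
def IsPrimitive (f f' : ℝ → R) : Prop :=
  IntervalIntegrable f' volume 0 1 ∧ ∀ t ∈ Icc (0 : ℝ) 1, f t = f 0 + ∫ s in (0 : ℝ)..t, f' s

lemma isPrimitive_const (c : R) : IsPrimitive (fun _ => c) (fun _ => (0 : R)) :=
  ⟨by simp, fun t _ => by simp⟩

lemma IsPrimitive.congr_right {f f' g' : ℝ → R} (h : IsPrimitive f f')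
    (hg : ∀ t ∈ Icc (0 : ℝ) 1, f' t = g' t) : IsPrimitive f g' := by
  refine ⟨h.1.congr fun t ht => ?_, fun t ht => ?_⟩
  · rw [uIoc_of_le (zero_le_one' ℝ)] at ht
    exact hg t (Ioc_subset_Icc_self ht)
  · rw [h.2 t ht]
    congr 1
    refine intervalIntegral.integral_congr fun s hs => hg s ?_
    rw [uIcc_of_le ht.1] at hs
    exact ⟨hs.1, hs.2.trans ht.2⟩

lemma IsPrimitive.sub_eq {f f' : ℝ → R} (h : IsPrimitive f f') {r t : ℝ}
    (hr : r ∈ Icc (0 : ℝ) 1) (ht : t ∈ Icc (0 : ℝ) 1) : f t - f r = ∫ s in r..t, f' s := by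
  rw [h.2 t ht, h.2 r hr, add_sub_add_left_eq_sub]
  have h0 : (0 : ℝ) ∈ Icc (0 : ℝ) 1 := by simp
  rw [intervalIntegral.integral_interval_sub_left] <;>
    exact intervalIntegrable_sub_Icc h.1 h0 ‹_›

lemma IsPrimitive.absolutelyContinuous {f f' : ℝ → R} (h : IsPrimitive f f') :
    AbsolutelyContinuousOnInterval f 0 1 := by
  have h1 := absolutelyContinuousOnInterval_integral h.1
  have h2 : AbsolutelyContinuousOnInterval (fun _ : ℝ => f 0) 0 1 :=
    LipschitzOnWith.absolutelyContinuousOnInterval (K := 0) fun x _ y _ => by simp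
  refine absolutelyContinuousOnInterval_congr (h2.add h1) fun t ht => ?_
  rw [uIcc_of_le (zero_le_one' ℝ)] at ht
  exact h.2 t ht

lemma IsPrimitive.continuousOn {f f' : ℝ → R} (h : IsPrimitive f f') :
    ContinuousOn f (Icc 0 1) := by
  simpa [uIcc_of_le (zero_le_one' ℝ)] using h.absolutelyContinuous.continuousOn

variable [CompleteSpace R]

lemma IsPrimitive.ae_hasDerivAt {f f' : ℝ → R} (h : IsPrimitive f f') :
    ∀ᵐ t, t ∈ Icc (0 : ℝ) 1 → HasDerivAt f (f' t) t := by
  have h0 : ∀ᵐ t : ℝ, t ≠ 0 := by simp [ae_iff, measure_singleton]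
  have h1 : ∀ᵐ t : ℝ, t ≠ 1 := by simp [ae_iff, measure_singleton]
  filter_upwards [h.1.ae_hasDerivAt_integral, h0, h1] with t ht ht0 ht1 hmem
  have h2 := (ht (by simpa [uIcc_of_le (zero_le_one' ℝ)] using hmem) 0 (by simp)).const_add (f 0)
  refine h2.congr_of_eventuallyEq ?_
  filter_upwards [Icc_mem_nhds (lt_of_le_of_ne hmem.1 ht0.symm) (lt_of_le_of_ne hmem.2 ht1)]
    with s hs
  exact h.2 s hs

/-- The product rule for primitives of integrable functions. -/
theorem IsPrimitive.mul {f f' g g' : ℝ → R} (hf : IsPrimitive f f') (hg : IsPrimitive g g') :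
    IsPrimitive (fun t => f t * g t) (fun t => f' t * g t + f t * g' t) := by
  have hu : uIcc (0 : ℝ) 1 = Icc 0 1 := uIcc_of_le zero_le_one
  have hi : IntervalIntegrable (fun t => f' t * g t + f t * g' t) volume 0 1 :=
    (hf.1.mul_continuousOn (hu ▸ hg.continuousOn)).add
      (hg.1.continuousOn_mul (hu ▸ hf.continuousOn))
  refine ⟨hi, fun t ht => ?_⟩
  have hac : AbsolutelyContinuousOnInterval
      ((fun t => f t * g t) - fun t => ∫ s in (0 : ℝ)..t, (f' s * g s + f s * g' s)) 0 1 :=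
    (AbsolutelyContinuousOnInterval.ring_mul hf.absolutelyContinuous hg.absolutelyContinuous).sub
      (absolutelyContinuousOnInterval_integral hi)
  -- The generator is merely integrable in time, so derivatives exist only almost everywhere;
  -- absolute continuity is what makes the difference constant.
  obtain ⟨C, hC⟩ := hac.const_of_ae_hasDerivAt_zero (by
    filter_upwards [hf.ae_hasDerivAt, hg.ae_hasDerivAt, hi.ae_hasDerivAt_integral]
      with s h1 h2 h3 hs
    have h := ((h1 (hu ▸ hs)).mul (h2 (hu ▸ hs))).sub (h3 hs 0 (by simp))
    rw [sub_self] at h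
    exact h)
  have h0 := hC 0 (by simp)
  have h1 := hC t (hu ▸ ht)
  simp only [Pi.sub_apply, intervalIntegral.integral_same, sub_zero] at h0 h1
  dsimp only
  rw [h0, ← h1, sub_add_cancel]

lemma IsPrimitive.star [StarRing R] [NormedStarGroup R] [StarModule ℝ R] {f f' : ℝ → R}
    (hf : IsPrimitive f f') : IsPrimitive (fun t => star (f t)) (fun t => star (f' t)) := by
  have h0 : (0 : ℝ) ∈ Icc (0 : ℝ) 1 := by simp
  let L : R →L[ℝ] R := (starL' ℝ : R ≃L[ℝ] R)
  refine ⟨⟨L.integrable_comp hf.1.1, L.integrable_comp hf.1.2⟩, fun t ht => ?_⟩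
  have h := L.intervalIntegral_comp_comm (intervalIntegrable_sub_Icc hf.1 h0 ht)
  simp only [L, ContinuousLinearEquiv.coe_coe, starL'_apply] at h
  dsimp only
  rw [h, hf.2 t ht, star_add]

end ProductRule

/-! ### Commutator bounds for sums of local terms -/

section Ring

variable {R : Type*} [Ring R]

/-- The Jacobi identity. With c a gate, each inner bracket keeps only the terms touching one site,
so the bounds do not grow with the system. -/
lemma lie_lie_eq (a b c : R) : ⁅⁅a, b⁆, c⁆ = ⁅b, ⁅c, a⁆⁆ - ⁅a, ⁅c, b⁆⁆ := by
  simp only [Ring.lie_def]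
  noncomm_ring

lemma lie_finset_sum {ι : Type*} (a : R) (s : Finset ι) (f : ι → R) :
    ⁅a, ∑ i ∈ s, f i⁆ = ∑ i ∈ s, ⁅a, f i⁆ := by
  simp only [Ring.lie_def, Finset.sum_mul, Finset.mul_sum, Finset.sum_sub_distrib]

end Ring

section Decompositions

variable {V : Type*} [Fintype V] [DecidableEq V] {q : ℕ}

/-- The commutator of an operator localized in `S` with a sum of local terms is bounded by the
size of `S`. -/
lemma norm_lie_sum_le {Hs : Finset V → QOp V q} {h : ℝ} (hs : ∀ S, SupportedIn (Hs S) S)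
    (hb : ∀ i, ∑ S : Finset V with i ∈ S, ‖Hs S‖ ≤ h) {O : QOp V q} {S : Finset V}
    (hO : CommutesOff O S) : ‖⁅∑ Z, Hs Z, O⁆‖ ≤ 2 * h * S.card * ‖O‖ := by
  have h1 : ∀ Z, ‖⁅Hs Z, O⁆‖ ≤ ∑ j ∈ S, if j ∈ Z then 2 * ‖Hs Z‖ * ‖O‖ else 0 := by
    intro Z
    have hnn : ∀ j ∈ S, 0 ≤ if j ∈ Z then 2 * ‖Hs Z‖ * ‖O‖ else 0 := fun j _ => by
      split_ifs <;> positivity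
    by_cases hd : Disjoint Z S
    · rw [Ring.lie_def, (hO _ Z hd (hs Z)).eq, sub_self, norm_zero]
      exact Finset.sum_nonneg hnn
    · obtain ⟨j, hjZ, hjS⟩ := Finset.not_disjoint_iff.mp hd
      refine (norm_lie_le _ _).trans ?_
      refine le_trans ?_ (Finset.single_le_sum hnn hjS)
      rw [if_pos hjZ]
  have h2 : ⁅∑ Z, Hs Z, O⁆ = ∑ Z, ⁅Hs Z, O⁆ := by
    simp only [Ring.lie_def, Finset.sum_mul, Finset.mul_sum, Finset.sum_sub_distrib]
  rw [h2]
  calc ‖∑ Z, ⁅Hs Z, O⁆‖ ≤ ∑ Z, ∑ j ∈ S, if j ∈ Z then 2 * ‖Hs Z‖ * ‖O‖ else 0 :=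
        norm_sum_le_of_le _ fun Z _ => h1 Z
    _ = ∑ j ∈ S, 2 * (∑ Z : Finset V with j ∈ Z, ‖Hs Z‖) * ‖O‖ := by
        rw [Finset.sum_comm]
        refine Finset.sum_congr rfl fun j _ => ?_
        rw [← Finset.sum_filter, Finset.mul_sum, Finset.sum_mul]
    _ ≤ ∑ _j ∈ S, 2 * h * ‖O‖ := by
        refine Finset.sum_le_sum fun j _ => ?_
        have := hb j
        gcongr
    _ = 2 * h * S.card * ‖O‖ := by
        rw [Finset.sum_const, nsmul_eq_mul]
        ring

/-- The double commutator of `Y` with a gate and a sum of local terms, when the commutator of `Y`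
with any localized operator is bounded by the size of its support. -/
lemma norm_lie_gate_lie_sum_le {As : Finset V → QOp V q} {a c : ℝ}
    (hs : ∀ S, SupportedIn (As S) S)
    (ha : ∀ i, ∑ S : Finset V with i ∈ S, (S.card : ℝ) * ‖As S‖ ≤ a) (hc : 0 ≤ c) {Y : QOp V q}
    (hY : ∀ (S : Finset V) (O : QOp V q), CommutesOff O S → ‖⁅Y, O⁆‖ ≤ c * S.card * ‖O‖)
    (i : V) (g : Gate q) : ‖⁅Y, ⁅siteGate i g, ∑ S, As S⁆⁆‖ ≤ 2 * c * a := by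
  have h2 : ⁅Y, ⁅siteGate i g, ∑ S, As S⁆⁆
      = ∑ S : Finset V with i ∈ S, ⁅Y, ⁅siteGate i g, As S⁆⁆ := by
    have h3 : ∑ S : Finset V with i ∈ S, ⁅Y, ⁅siteGate i g, As S⁆⁆
        = ∑ S : Finset V, ⁅Y, ⁅siteGate i g, As S⁆⁆ := by
      refine Finset.sum_filter_of_ne fun S _ hne => ?_
      by_contra hi
      refine hne ?_
      rw [Ring.lie_def (siteGate i g),
        ((supportedIn_siteGate i g).commute (hs S) (by simpa using hi)).eq, sub_self]
      simp [Ring.lie_def]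
    rw [h3, lie_finset_sum, lie_finset_sum]
  rw [h2]
  calc ‖∑ S : Finset V with i ∈ S, ⁅Y, ⁅siteGate i g, As S⁆⁆‖
      ≤ ∑ S : Finset V with i ∈ S, 2 * c * ((S.card : ℝ) * ‖As S‖) := by
        refine norm_sum_le_of_le _ fun S hS => ?_
        have hi : i ∈ S := by simpa using hS
        -- Since i ∈ S, the bracket of the gate with `As S` stays localized in S.
        have hg : CommutesOff (siteGate i g) S := fun K T hT hK =>
          hK.commute (supportedIn_siteGate i g)
            (Finset.disjoint_singleton_right.mpr fun h => Finset.disjoint_left.mp hT h hi)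
        refine (hY S _ (hg.lie (hs S).commutesOff)).trans ?_
        have h4 : ‖⁅siteGate i g, As S⁆‖ ≤ 2 * ‖As S‖ := by
          refine (norm_lie_le _ _).trans ?_
          have := norm_siteGate_le i g
          have := mul_le_mul_of_nonneg_right this (norm_nonneg (As S))
          linarith
        calc c * S.card * ‖⁅siteGate i g, As S⁆‖ ≤ c * S.card * (2 * ‖As S‖) := by gcongr
          _ = _ := by ring
    _ ≤ 2 * c * a := by
        rw [← Finset.mul_sum]
        have := ha i
        gcongr

/-- The commutator of two sums of local terms almost commutes with every gate. -/
lemma norm_lie_lie_gate_le {Hs As : Finset V → QOp V q} {a a' h h' : ℝ}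
    (hHs : ∀ S, SupportedIn (Hs S) S) (hAs : ∀ S, SupportedIn (As S) S)
    (hh0 : 0 ≤ h) (ha0 : 0 ≤ a)
    (hh : ∀ i, ∑ S : Finset V with i ∈ S, ‖Hs S‖ ≤ h)
    (ha : ∀ i, ∑ S : Finset V with i ∈ S, ‖As S‖ ≤ a)
    (hh' : ∀ i, ∑ S : Finset V with i ∈ S, (S.card : ℝ) * ‖Hs S‖ ≤ h')
    (ha' : ∀ i, ∑ S : Finset V with i ∈ S, (S.card : ℝ) * ‖As S‖ ≤ a')
    (i : V) (g : Gate q) :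
    ‖⁅⁅∑ S, Hs S, ∑ S, As S⁆, siteGate i g⁆‖ ≤ 4 * h * a' + 4 * a * h' := by
  have h1 := norm_lie_gate_lie_sum_le hAs ha' (c := 2 * h) (by positivity)
    (fun S O hO => norm_lie_sum_le hHs hh hO) i g
  have h2 := norm_lie_gate_lie_sum_le hHs hh' (c := 2 * a) (by positivity)
    (fun S O hO => norm_lie_sum_le hAs ha hO) i g
  have e : ⁅⁅∑ S, Hs S, ∑ S, As S⁆, siteGate i g⁆
      = ⁅∑ S, As S, ⁅siteGate i g, ∑ S, Hs S⁆⁆ - ⁅∑ S, Hs S, ⁅siteGate i g, ∑ S, As S⁆⁆ := by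
    exact lie_lie_eq _ _ _
  rw [e]
  refine (norm_sub_le _ _).trans ?_
  linarith

end Decompositions

/-! ### Unitary evolution and the Gronwall iteration -/

section Evolution

open MeasureTheory Set

variable {R : Type*} [NormedRing R] [StarRing R] [CStarRing R] [NormedAlgebra ℝ R]
  [StarModule ℝ R] [CompleteSpace R]

/-- `W` solves `W' = A W`, `W 0 = 1` on `[0, 1]` with an anti-Hermitian generator. -/
structure IsPropagator (A W : ℝ → R) : Prop where
  primitive : IsPrimitive W fun s => A s * W s
  zero : W 0 = 1
  skew : ∀ s ∈ Icc (0 : ℝ) 1, star (A s) = -A s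

namespace IsPropagator

variable {A W : ℝ → R}

/-- The Heisenberg equation. -/
lemma heisenberg (hW : IsPropagator A W) (K : R) :
    IsPrimitive (fun t => star (W t) * K * W t) fun t => star (W t) * ⁅K, A t⁆ * W t := by
  refine ((hW.primitive.star.mul (isPrimitive_const K)).mul hW.primitive).congr_right
    fun t ht => ?_
  simp only [star_mul, hW.skew t ht, Ring.lie_def]
  noncomm_ring

lemma star_mul_self (hW : IsPropagator A W) {t : ℝ} (ht : t ∈ Icc (0 : ℝ) 1) :
    star (W t) * W t = 1 := by
  have h := (hW.heisenberg 1).2 t ht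
  simpa [hW.zero, Ring.lie_def] using h

lemma mul_star_self [IsDedekindFiniteMonoid R] (hW : IsPropagator A W) {t : ℝ} (ht : t ∈ Icc (0 : ℝ) 1) :
    W t * star (W t) = 1 :=
  mul_eq_one_symm (hW.star_mul_self ht)

lemma norm_le (hW : IsPropagator A W) {t : ℝ} (ht : t ∈ Icc (0 : ℝ) 1) : ‖W t‖ ≤ 1 := by
  have h : ‖star (W t) * W t‖ = ‖W t‖ * ‖W t‖ := CStarRing.norm_star_mul_self
  rw [hW.star_mul_self ht] at h
  have h1 : ‖star (1 : R) * 1‖ = ‖(1 : R)‖ * ‖(1 : R)‖ := CStarRing.norm_star_mul_self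
  rw [star_one, one_mul] at h1
  -- From ‖1‖ = ‖1‖². The zero ring is allowed, so ‖1‖ may vanish.
  have h2 : ‖(1 : R)‖ ≤ 1 := by nlinarith
  nlinarith [norm_nonneg (W t), norm_nonneg (1 : R)]

lemma norm_star_mul_mul_le (hW : IsPropagator A W) {t : ℝ} (ht : t ∈ Icc (0 : ℝ) 1)
    (X : R) : ‖star (W t) * X * W t‖ ≤ ‖X‖ := by
  have h := hW.norm_le ht
  calc ‖star (W t) * X * W t‖ ≤ ‖star (W t)‖ * ‖X‖ * ‖W t‖ :=
        (norm_mul_le _ _).trans (mul_le_mul_of_nonneg_right (norm_mul_le _ _) (norm_nonneg _))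
    _ ≤ 1 * ‖X‖ * 1 := by rw [norm_star]; gcongr
    _ = ‖X‖ := by ring

lemma norm_mul_mul_star_le (hW : IsPropagator A W) {t : ℝ} (ht : t ∈ Icc (0 : ℝ) 1)
    (X : R) : ‖W t * X * star (W t)‖ ≤ ‖X‖ := by
  have h := hW.norm_le ht
  calc ‖W t * X * star (W t)‖ ≤ ‖W t‖ * ‖X‖ * ‖star (W t)‖ :=
        (norm_mul_le _ _).trans (mul_le_mul_of_nonneg_right (norm_mul_le _ _) (norm_nonneg _))
    _ ≤ 1 * ‖X‖ * 1 := by rw [norm_star]; gcongr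
    _ = ‖X‖ := by ring

lemma lie_conj (hW : IsPropagator A W) {t : ℝ} (ht : t ∈ Icc (0 : ℝ) 1) (Z K : R) :
    star (W t) * ⁅W t * Z * star (W t), K⁆ * W t = ⁅Z, star (W t) * K * W t⁆ := by
  have h1 : star (W t) * (W t * Z * star (W t) * K - K * (W t * Z * star (W t))) * W t
      = (star (W t) * W t) * Z * (star (W t) * K * W t)
        - (star (W t) * K * W t) * Z * (star (W t) * W t) := by noncomm_ring
  rw [Ring.lie_def, Ring.lie_def, h1, hW.star_mul_self ht, one_mul, mul_one]

lemma conj_lie [IsDedekindFiniteMonoid R] (hW : IsPropagator A W) {t : ℝ} (ht : t ∈ Icc (0 : ℝ) 1) (Z K : R) :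
    ⁅W t * Z * star (W t), K⁆ = W t * ⁅Z, star (W t) * K * W t⁆ * star (W t) := by
  rw [← hW.lie_conj ht]
  have h1 : ∀ X : R, W t * (star (W t) * X * W t) * star (W t)
      = (W t * star (W t)) * X * (W t * star (W t)) := fun X => by noncomm_ring
  rw [h1, hW.mul_star_self ht, one_mul, mul_one]

/-- One step of the Gronwall iteration for the commutators with the family `P`. -/
lemma norm_lie_step [IsDedekindFiniteMonoid R] (hW : IsPropagator A W) {ι : Type*} {P : ι → R} {s : ℝ} (hs : s ∈ Icc (0 : ℝ) 1) {θ : ℝ}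
    (hθ : 0 < θ)
    (hA : ∀ t ∈ Icc (0 : ℝ) 1, ∀ (Y : R) (δ : ℝ),
      (∀ i, ‖⁅Y, P i⁆‖ ≤ δ) → ∀ i, ‖⁅Y, ⁅P i, A t⁆⁆‖ ≤ θ * δ)
    {B : R} {b : ℝ} (hb : ∀ i, ‖⁅B, P i⁆‖ ≤ b) (hb0 : 0 ≤ b)
    {Z : R} (hZ : Z = star (W s) * B * W s) {k : ℝ} (hk0 : 0 ≤ k)
    (hk : ∀ r ∈ Icc 0 s, ∀ i,
      ‖⁅W r * Z * star (W r), P i⁆‖ ≤ k * Real.exp (2 * θ * (s - r))) :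
    ∀ r ∈ Icc 0 s, ∀ i,
      ‖⁅W r * Z * star (W r), P i⁆‖ ≤ (b + k / 2) * Real.exp (2 * θ * (s - r)) := by
  intro r hr i
  have hr1 : r ∈ Icc (0 : ℝ) 1 := ⟨hr.1, hr.2.trans hs.2⟩
  have hsub := (hW.heisenberg (P i)).sub_eq hr1 hs
  have hint : IntervalIntegrable (fun t => star (W t) * ⁅P i, A t⁆ * W t) volume r s :=
    intervalIntegrable_sub_Icc (hW.heisenberg (P i)).1 hr1 hs
  have hWZ : W s * Z * star (W s) = B := by
    have : W s * (star (W s) * B * W s) * star (W s)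
        = (W s * star (W s)) * B * (W s * star (W s)) := by noncomm_ring
    rw [hZ, this, hW.mul_star_self hs, one_mul, mul_one]
  have hfin : ‖⁅Z, star (W s) * P i * W s⁆‖ ≤ b := by
    rw [← hW.lie_conj hs, hWZ]
    exact (hW.norm_star_mul_mul_le hs _).trans (hb i)
  have hadd : ∀ X₁ X₂ : R, ⁅Z, X₁⁆ = ⁅Z, X₂⁆ - ⁅Z, X₂ - X₁⁆ := fun X₁ X₂ => by
    simp only [Ring.lie_def]
    noncomm_ring
  have hlie : ∀ F : ℝ → R, IntervalIntegrable F volume r s →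
      ⁅Z, ∫ t in r..s, F t⁆ = ∫ t in r..s, ⁅Z, F t⁆ := fun F hF => by
    have h1 := ((ContinuousLinearMap.mul ℝ R Z).intervalIntegral_comp_comm hF)
    have h2 := (((ContinuousLinearMap.mul ℝ R).flip Z).intervalIntegral_comp_comm hF)
    simp only [ContinuousLinearMap.mul_apply', ContinuousLinearMap.flip_apply] at h1 h2
    simp only [Ring.lie_def]
    rw [intervalIntegral.integral_sub (hF.continuousOn_mul continuousOn_const)
      (hF.mul_continuousOn continuousOn_const), h1, h2]
  -- The weight grows at rate 2θ, twice the Gronwall rate, so that integration halves k and the step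
  -- is a contraction.
  have hexp : ∫ t in r..s, θ * (k * Real.exp (2 * θ * (s - t)))
      = k / 2 * Real.exp (2 * θ * (s - r)) - k / 2 := by
    have hd : ∀ t ∈ uIcc r s, HasDerivAt (fun t => -(k / 2 * Real.exp (2 * θ * (s - t))))
        (θ * (k * Real.exp (2 * θ * (s - t)))) t := fun t _ => by
      have h := (((((hasDerivAt_id' t).const_sub s).const_mul (2 * θ)).exp).const_mul (k / 2)).neg
      exact h.congr_deriv (by ring)
    rw [intervalIntegral.integral_eq_sub_of_hasDerivAt hd
      (Continuous.intervalIntegrable (by fun_prop) _ _)]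
    simp
    ring
  have hbound : ‖∫ t in r..s, ⁅Z, star (W t) * ⁅P i, A t⁆ * W t⁆‖
      ≤ k / 2 * Real.exp (2 * θ * (s - r)) - k / 2 := by
    rw [← hexp]
    refine intervalIntegral.norm_integral_le_of_norm_le hr.2 (Filter.Eventually.of_forall ?_)
      (Continuous.intervalIntegrable (by fun_prop) _ _)
    intro t ht
    have ht' : t ∈ Icc 0 s := ⟨hr.1.trans ht.1.le, ht.2⟩
    have ht1 : t ∈ Icc (0 : ℝ) 1 := ⟨ht'.1, ht'.2.trans hs.2⟩
    -- The evolution is moved from the gate onto Z. Then `hA` applies to W(t) Z W(t)†, whose gate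
    -- commutators `hk` bounds: the estimate closes.
    rw [← hW.lie_conj ht1]
    exact (hW.norm_star_mul_mul_le ht1 _).trans (hA t ht1 _ _ (hk t ht') i)
  rw [hW.conj_lie hr1]
  refine (hW.norm_mul_mul_star_le hr1 _).trans ?_
  rw [hadd _ (star (W s) * P i * W s), hsub, hlie _ hint]
  refine (norm_sub_le _ _).trans ((add_le_add hfin hbound).trans ?_)
  have h1 : 1 ≤ Real.exp (2 * θ * (s - r)) :=
    Real.one_le_exp (mul_nonneg (by positivity) (sub_nonneg.mpr hr.2))
  nlinarith

/-- The evolution of `B` almost commutes with the family `P` if `B` does. -/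
theorem norm_lie_evolution_le [IsDedekindFiniteMonoid R] (hW : IsPropagator A W) {ι : Type*} {P : ι → R}
    (hP : ∀ i, ‖P i‖ ≤ 1) {s : ℝ} (hs : s ∈ Icc (0 : ℝ) 1) {θ : ℝ}
    (hθ : 0 < θ)
    (hA : ∀ t ∈ Icc (0 : ℝ) 1, ∀ (Y : R) (δ : ℝ),
      (∀ i, ‖⁅Y, P i⁆‖ ≤ δ) → ∀ i, ‖⁅Y, ⁅P i, A t⁆⁆‖ ≤ θ * δ)
    {B : R} {b : ℝ} (hb : ∀ i, ‖⁅B, P i⁆‖ ≤ b) (hb0 : 0 ≤ b)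
    (i : ι) :
    ‖⁅star (W s) * B * W s, P i⁆‖ ≤ 2 * b * Real.exp (2 * θ) := by
  set Z := star (W s) * B * W s with hZ
  -- The map k ↦ b + k/2 has fixed point 2b; the crude initial bound 2‖Z‖, which may grow with the
  -- system, is halved away. Iterating pointwise bounds needs no regularity in time of a supremum
  -- over gates.
  have hiter : ∀ n : ℕ, ∀ r ∈ Icc 0 s, ∀ i, ‖⁅W r * Z * star (W r), P i⁆‖
      ≤ (2 * b + 2 * ‖Z‖ * (1 / 2) ^ n) * Real.exp (2 * θ * (s - r)) := by
    intro n
    induction n with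
    | zero =>
      intro r hr i
      have hr1 : r ∈ Icc (0 : ℝ) 1 := ⟨hr.1, hr.2.trans hs.2⟩
      have h1 : 1 ≤ Real.exp (2 * θ * (s - r)) :=
        Real.one_le_exp (mul_nonneg (by positivity) (sub_nonneg.mpr hr.2))
      calc _ ≤ 2 * ‖W r * Z * star (W r)‖ * ‖P i‖ := norm_lie_le _ _
        _ ≤ 2 * ‖Z‖ * 1 := by
          gcongr
          exacts [hW.norm_mul_mul_star_le hr1 Z, hP i]
        _ ≤ (2 * b + 2 * ‖Z‖ * (1 / 2) ^ 0) * 1 := by rw [pow_zero]; linarith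
        _ ≤ _ := by gcongr
    | succ n ih =>
      intro r hr i
      refine (hW.norm_lie_step hs hθ hA hb hb0 hZ (by positivity) ih r hr i).trans
        (le_of_eq ?_)
      rw [pow_succ]
      ring
  have h0 : (0 : ℝ) ∈ Icc 0 s := ⟨le_rfl, hs.1⟩
  have hlim : Filter.Tendsto
      (fun n : ℕ => (2 * b + 2 * ‖Z‖ * (1 / 2) ^ n) * Real.exp (2 * θ * (s - 0))) Filter.atTop
      (nhds ((2 * b + 2 * ‖Z‖ * 0) * Real.exp (2 * θ * (s - 0)))) :=
    (((tendsto_pow_atTop_nhds_zero_of_lt_one (by norm_num) (by norm_num)).const_mul _).const_add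
      _).mul_const _
  have h := ge_of_tendsto' hlim fun n => hiter n 0 h0 i
  rw [hW.zero, star_one, one_mul, mul_one] at h
  refine h.trans ?_
  rw [mul_zero, add_zero, sub_zero]
  have := hs.2
  exact mul_le_mul_of_nonneg_left (Real.exp_le_exp.mpr (by nlinarith)) (by positivity)

end IsPropagator

end Evolution

/-! ### Volume growth against exponential weights -/

section Geometry

variable {V : Type*} [Fintype V] [DecidableEq V] {q : ℕ}

/-- The volume of a connected set is absorbed by an exponential of its diameter. -/
lemma IsDimensional.card_le_exp {G : SimpleGraph V} {d : ℕ} {cd κ : ℝ} (hG : IsDimensional G d cd)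
    (hcd : 0 < cd) (hκ : 0 < κ) (hκ1 : κ ≤ 1) {S : Finset V} (hS : ConnectedIn G S) :
    (S.card : ℝ) ≤ cd * d.factorial / κ ^ d * Real.exp (κ * (diam G S : ℝ)) := by
  refine (hG S hS).2.trans ?_
  have hf : (0 : ℝ) < d.factorial := by exact_mod_cast d.factorial_pos
  have h : (max 1 (diam G S : ℝ)) ^ d * κ ^ d ≤ d.factorial * Real.exp (κ * (diam G S : ℝ)) := by
    rcases le_total (1 : ℝ) (diam G S) with h1 | h1
    · rw [max_eq_right h1, ← mul_pow, mul_comm (diam G S : ℝ)]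
      have := Real.pow_div_factorial_le_exp (κ * (diam G S : ℝ)) (by positivity) d
      rwa [div_le_iff₀' hf] at this
    · rw [max_eq_left h1, one_pow, one_mul]
      calc κ ^ d ≤ 1 := pow_le_one₀ hκ.le hκ1
        _ = 1 * 1 := (one_mul 1).symm
        _ ≤ _ := by
          gcongr
          · exact_mod_cast d.factorial_pos
          · exact Real.one_le_exp (by positivity)
  rw [div_mul_eq_mul_div, le_div_iff₀ (by positivity)]
  have := mul_le_mul_of_nonneg_left h hcd.le
  linarith

lemma LocalNormLE.sum_norm_le {G : SimpleGraph V} {κ b : ℝ} {Os : Finset V → QOp V q}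
    (h : LocalNormLE G κ Os b) (hκ : 0 < κ) (i : V) :
    ∑ S : Finset V with i ∈ S, ‖Os S‖ ≤ b := by
  refine le_trans (Finset.sum_le_sum fun S _ => ?_) (h i)
  exact le_mul_of_one_le_left (norm_nonneg _) (Real.one_le_exp (by positivity))

/-- The whole exponential weight is spent on the volume factor; no decay has to survive for the
later estimates. -/
lemma LocalNormLE.sum_card_mul_norm_le {G : SimpleGraph V} {d : ℕ} {cd κ b : ℝ}
    {O : QOp V q} {Os : Finset V → QOp V q} (h : LocalNormLE G κ Os b)
    (hO : IsLocalDecomp G O Os) (hG : IsDimensional G d cd)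
    (hcd : 0 < cd) (hκ : 0 < κ) (hκ1 : κ ≤ 1) (i : V) :
    ∑ S : Finset V with i ∈ S, (S.card : ℝ) * ‖Os S‖ ≤ cd * d.factorial / κ ^ d * b := by
  refine le_trans (Finset.sum_le_sum (g := fun S => cd * d.factorial / κ ^ d *
    (Real.exp (κ * (diam G S : ℝ)) * ‖Os S‖)) fun S _ => ?_) ?_
  · by_cases hS : Os S = 0
    · simp [hS]
    · rw [← mul_assoc]
      exact mul_le_mul_of_nonneg_right (hG.card_le_exp hcd hκ hκ1 (hO.connected S hS))
        (norm_nonneg _)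
  · rw [← Finset.mul_sum]
    exact mul_le_mul_of_nonneg_left (h i) (by positivity)

end Geometry

/-! ### Metastability under conjugation by the propagator -/

section Stability

open MeasureTheory Set

variable {V : Type*} [Fintype V] [DecidableEq V] {q : ℕ}

/-- Holds by finite dimension. It upgrades W†W = 1, read off from the Heisenberg equation, to
unitarity. -/
instance : IsDedekindFiniteMonoid (QOp V q) where
  mul_eq_one_symm {f g} h := by
    have h' : (f : QState V q →ₗ[ℂ] QState V q) * (g : QState V q →ₗ[ℂ] QState V q) = 1 :=
      congrArg (fun O : QOp V q => (O : QState V q →ₗ[ℂ] QState V q)) h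
    ext1 ψ
    exact LinearMap.congr_fun (mul_eq_one_symm h') ψ

lemma IsTimeOrderedExp.exists_isPropagator {A : ℝ → QOp V q} {U : QOp V q}
    (hU : IsTimeOrderedExp A U) (hA : IntervalIntegrable A volume 0 1)
    (hskew : ∀ s ∈ Icc (0 : ℝ) 1, star (A s) = -A s) :
    ∃ W : ℝ → QOp V q, IsPropagator A W ∧ W 1 = U := by
  obtain ⟨W, hc, hW, h1⟩ := hU
  have h0 : W 0 = 1 := by simpa using hW 0 (by simp)
  refine ⟨W, ⟨⟨hA.mul_continuousOn (by rwa [uIcc_of_le zero_le_one]), fun t ht => ?_⟩, h0, hskew⟩,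
    h1⟩
  rw [hW t ht, h0]

/-- The change of the excess energy of a localized excitation under the conjugation by the
propagator. -/
theorem norm_expectation_conj_sub_le [NeZero q] {A W : ℝ → QOp V q} (hW : IsPropagator A W)
    {H : QOp V q} {S : Finset V} {δ : ℝ}
    (hδ : ∀ s ∈ Icc (0 : ℝ) 1, ∀ (i : V) (g : Gate q),
      ‖⁅star (W s) * ⁅H, A s⁆ * W s, siteGate i g⁆‖ ≤ δ)
    {φ : QState V q} (hφ0 : φ ≠ 0) (hφ : ∀ x, φ x ≠ 0 → ∀ i, i ∉ S → x i = 0) :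
    ‖inner ℂ φ ((star (W 1) * H * W 1 - H) φ) / (‖φ‖ : ℂ) ^ 2
        - inner ℂ (zeroState V q) ((star (W 1) * H * W 1 - H) (zeroState V q))‖
      ≤ 4 * S.card * δ := by
  let ev : QState V q → (QOp V q →L[ℂ] ℂ) := fun ψ =>
    (innerSL ℂ ψ).comp (ContinuousLinearMap.apply ℂ (QState V q) ψ)
  let L : QOp V q →L[ℂ] ℂ := ((‖φ‖ : ℂ) ^ 2)⁻¹ • ev φ - ev (zeroState V q)
  have hL : ∀ Y : QOp V q, L Y = inner ℂ φ (Y φ) / (‖φ‖ : ℂ) ^ 2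
      - inner ℂ (zeroState V q) (Y (zeroState V q)) := fun Y => by
    simp [L, ev, div_eq_inv_mul]
  have h1 : star (W 1) * H * W 1 - H = ∫ s in (0 : ℝ)..1, star (W s) * ⁅H, A s⁆ * W s := by
    have h := (hW.heisenberg H).2 1 (by simp)
    simp only [hW.zero, star_one, one_mul, mul_one] at h
    rw [h, add_sub_cancel_left]
  rw [← hL, h1, ← L.intervalIntegral_comp_comm (hW.heisenberg H).1]
  refine (intervalIntegral.norm_integral_le_of_norm_le_const (C := 4 * S.card * δ)
    fun s hs => ?_).trans (by simp)
  rw [uIoc_of_le zero_le_one] at hs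
  rw [hL]
  exact abs_expectation_sub_le (fun j _ g => hδ s (Ioc_subset_Icc_self hs) j g) hφ0 hφ

lemma energy_of_ne_zero (H : QOp V q) {ψ : QState V q} (h : ψ ≠ 0) :
    energy H ψ = (((inner ℂ ψ (H ψ)).re / ‖ψ‖ ^ 2 : ℝ) : EReal) := if_neg h

lemma le_energy_zero_sub (H : QOp V q) {ψ : QState V q} (h : ψ ≠ 0) (x : EReal) :
    x ≤ energy H 0 - energy H ψ := by
  rw [energy_of_ne_zero H h, energy, if_pos rfl, EReal.top_sub_coe]
  exact le_top

end Stability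

section Stability

open MeasureTheory Set

variable {V : Type*} [Fintype V] [DecidableEq V] {q : ℕ}

/-- The conjugated commutator of two exponentially localized operators almost commutes with the
gates, uniformly in the system. -/
theorem norm_lie_conj_lie_gate_le [NeZero q] {G : SimpleGraph V} {d : ℕ} {cd κ a h : ℝ}
    (hG : IsDimensional G d cd) (hcd : 0 < cd) (hκ : 0 < κ) (hκ1 : κ ≤ 1) (ha0 : 0 ≤ a)
    (haκ : a ≤ κ ^ d) (hh0 : 0 ≤ h)
    {H : QOp V q} {Hs : Finset V → QOp V q} (hH : IsLocalDecomp G H Hs)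
    (hHn : LocalNormLE G κ Hs h)
    {A W : ℝ → QOp V q} {As : ℝ → Finset V → QOp V q} (hW : IsPropagator A W)
    (hA : ∀ s ∈ Icc (0 : ℝ) 1, IsLocalDecomp G (A s) (As s))
    (hAn : ∀ s ∈ Icc (0 : ℝ) 1, LocalNormLE G κ (As s) a)
    {s : ℝ} (hs : s ∈ Icc (0 : ℝ) 1) (i : V) (g : Gate q) :
    ‖⁅star (W s) * ⁅H, A s⁆ * W s, siteGate i g⁆‖ ≤
      16 * (cd * d.factorial / κ ^ d * a * h) * Real.exp (16 * (cd * d.factorial)) := by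
  set c := cd * d.factorial with hc
  have hf : (0 : ℝ) < d.factorial := by exact_mod_cast d.factorial_pos
  have hc0 : 0 < c := by positivity
  -- Smallness of A makes the Gronwall rate 8c independent of μ; the exponential 16c is twice that
  -- rate.
  have hca : c / κ ^ d * a ≤ c := by
    rw [div_mul_eq_mul_div, div_le_iff₀ (by positivity)]
    gcongr
  have hgen : ∀ t ∈ Icc (0 : ℝ) 1, ∀ (Y : QOp V q) (δ : ℝ),
      (∀ p : V × Gate q, ‖⁅Y, siteGate p.1 p.2⁆‖ ≤ δ) →
      ∀ p : V × Gate q, ‖⁅Y, ⁅siteGate p.1 p.2, A t⁆⁆‖ ≤ 8 * c * δ := by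
    intro t ht Y δ hY p
    have hδ : 0 ≤ δ := (norm_nonneg _).trans (hY p)
    have h1 := norm_lie_gate_lie_sum_le (hA t ht).supported
      ((hAn t ht).sum_card_mul_norm_le (hA t ht) hG hcd hκ hκ1) (c := 4 * δ) (by positivity)
      (fun S O hO => (norm_lie_le_of_gates (fun j _ g => hY (j, g)) hO).trans
        (le_of_eq (by ring))) p.1 p.2
    rw [← (hA t ht).sum_eq] at h1
    refine h1.trans ?_
    have := mul_le_mul_of_nonneg_left hca hδ
    linarith
  have hB : ∀ p : V × Gate q, ‖⁅⁅H, A s⁆, siteGate p.1 p.2⁆‖ ≤ 8 * (c / κ ^ d * a * h) := by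
    intro p
    have h1 := norm_lie_lie_gate_le hH.supported (hA s hs).supported hh0 ha0
      (hHn.sum_norm_le hκ) ((hAn s hs).sum_norm_le hκ)
      (hHn.sum_card_mul_norm_le hH hG hcd hκ hκ1)
      ((hAn s hs).sum_card_mul_norm_le (hA s hs) hG hcd hκ hκ1) p.1 p.2
    rw [← hH.sum_eq, ← (hA s hs).sum_eq] at h1
    exact h1.trans (le_of_eq (by ring))
  have h := hW.norm_lie_evolution_le (P := fun p : V × Gate q => siteGate p.1 p.2)
    (fun p => norm_siteGate_le p.1 p.2) hs (by positivity) hgen hB (by positivity) (i, g)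
  refine h.trans (le_of_eq ?_)
  congr 1
  · ring
  · congr 1
    ring

/-- Metastability passes to a Hamiltonian whose expectation on localized excitations differs from
that of `H` by at most `ε` per site. -/
theorem IsMetastable.of_expectation_sub_le [NeZero q] {G : SimpleGraph V} {H H' : QOp V q}
    {Δ R Δ' R' ε : ℝ} (hm : IsMetastable G H (zeroState V q) Δ R) (hR : R' ≤ R) (hR1 : 1 ≤ R')
    (hcard : ∀ S : Finset V, ConnectedIn G S → (diam G S : ℝ) ≤ R' → S.card * ε ≤ Δ - Δ')
    (hsub : ∀ (S : Finset V) (φ : QState V q), φ ≠ 0 → (∀ x, φ x ≠ 0 → ∀ i, i ∉ S → x i = 0) →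
      ‖inner ℂ φ ((H' - H) φ) / (‖φ‖ : ℂ) ^ 2
        - inner ℂ (zeroState V q) ((H' - H) (zeroState V q))‖ ≤ S.card * ε) :
    IsMetastable G H' (zeroState V q) Δ' R' := by
  refine ⟨hR1, fun S hS hd O hO hOS => ?_⟩
  have hz : ‖zeroState V q‖ = 1 := by simp [zeroState, ket]
  have hz0 : zeroState V q ≠ 0 := fun h => by simp [h] at hz
  have h1 := hm.2 S hS (hd.trans hR) O hO hOS
  have hφ := hOS.apply_zeroState_eq_zero (expect O (zeroState V q))
  generalize O (zeroState V q) - expect O (zeroState V q) • zeroState V q = φ at h1 hφ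
  by_cases hφ0 : φ = 0
  · rw [hφ0]
    exact le_energy_zero_sub H' hz0 _
  rw [energy_of_ne_zero _ hφ0, energy_of_ne_zero _ hz0, ← EReal.coe_sub, EReal.coe_le_coe_iff]
    at h1 ⊢
  have h2 := (Complex.abs_re_le_norm _).trans (hsub S φ hφ0 hφ)
  have h3 := hcard S hS hd
  have h4 := neg_le_of_abs_le h2
  have e : (inner ℂ φ ((H' - H) φ) / (‖φ‖ : ℂ) ^ 2).re
      = (inner ℂ φ (H' φ)).re / ‖φ‖ ^ 2 - (inner ℂ φ (H φ)).re / ‖φ‖ ^ 2 := by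
    rw [← Complex.ofReal_pow, Complex.div_ofReal_re, sub_apply, inner_sub_right, Complex.sub_re,
      sub_div]
  rw [Complex.sub_re, e, sub_apply, inner_sub_right, Complex.sub_re] at h4
  rw [hz] at h1 ⊢
  linarith

/-- The volume of connected sets of small diameter. -/
lemma IsDimensional.card_mul_le {G : SimpleGraph V} {d : ℕ} {cd Δ R ε : ℝ} (hd : 1 ≤ d)
    (hG : IsDimensional G d cd) (hcd : 0 < cd) (hε : 0 < ε) (hΔ : 0 < Δ)
    (hR1 : 1 ≤ R) (hR : R ≤ (Δ / (2 * cd * ε)) ^ ((1 : ℝ) / (d : ℝ)))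
    {S : Finset V} (hS : ConnectedIn G S) (hdiam : (diam G S : ℝ) ≤ R) :
    S.card * ε ≤ Δ / 2 := by
  have h1 : (max 1 (diam G S : ℝ)) ^ d ≤ Δ / (2 * cd * ε) := by
    calc (max 1 (diam G S : ℝ)) ^ d ≤ ((Δ / (2 * cd * ε)) ^ ((1 : ℝ) / (d : ℝ))) ^ d := by
          gcongr
          exact (max_le hR1 hdiam).trans hR
      _ = Δ / (2 * cd * ε) := by
          rw [one_div]
          exact Real.rpow_inv_natCast_pow (by positivity) (by lia)
  calc S.card * ε ≤ cd * (max 1 (diam G S : ℝ)) ^ d * ε := by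
        gcongr
        exact (hG S hS).2
    _ ≤ cd * (Δ / (2 * cd * ε)) * ε := by gcongr
    _ = Δ / 2 := by field_simp

end Stability

end Metastable

end

theorem mainTheorem8 (d : ℕ) (hd : 1 ≤ d) (cd : ℝ) (hcd : 0 < cd) :
    ∃ cm : ℝ, 0 < cm ∧
      ∀ (N q : ℕ) [NeZero q] (G : SimpleGraph (Fin N)), Metastable.IsDimensional G d cd →
      ∀ μ h Δ R ε : ℝ, 0 < μ → μ ≤ 1 / (2 * Real.exp 1) → 0 < h → 0 < Δ → 0 < ε →
      -- the Hamiltonian and its exponentially decaying decomposition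
      ∀ (H : Metastable.QOp (Fin N) q) (Hs : Finset (Fin N) → Metastable.QOp (Fin N) q),
        IsSelfAdjoint H →
        Metastable.IsLocalDecomp G H Hs →
        Metastable.LocalNormLE G (2 * μ) Hs h →
      -- the generator and its exponentially decaying decomposition
      ∀ (A : ℝ → Metastable.QOp (Fin N) q)
        (As : ℝ → Finset (Fin N) → Metastable.QOp (Fin N) q),
        (∀ S, IntervalIntegrable (fun s => As s S) MeasureTheory.volume 0 1) →
        (∀ s ∈ Set.Icc (0 : ℝ) 1, star (A s) = -A s) →
        (∀ s ∈ Set.Icc (0 : ℝ) 1, Metastable.IsLocalDecomp G (A s) (As s)) →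
        (∀ s ∈ Set.Icc (0 : ℝ) 1, Metastable.LocalNormLE G (2 * μ) (As s)
          (ε / (cm * h) * (2 * μ) ^ (4 * d - 2))) →
      -- smallness of `ε`; the second condition says that the new radius is at least one
        ε / (cm * h) * (2 * μ) ^ (4 * d - 2) < (2 * μ) ^ (6 * d + 2) →
        ε ≤ Δ / (2 * cd) →
      ∀ U : Metastable.QOp (Fin N) q, Metastable.IsTimeOrderedExp A U →
        Metastable.IsMetastable G H (Metastable.zeroState (Fin N) q) Δ R →
        Metastable.IsMetastable G (star U * H * U) (Metastable.zeroState (Fin N) q) (Δ / 2)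
          (min R ((Δ / (2 * cd * ε)) ^ ((1 : ℝ) / (d : ℝ)))) := by
  have hf : (0 : ℝ) < d.factorial := by exact_mod_cast d.factorial_pos
  set c : ℝ := cd * d.factorial with hc
  have hc0 : 0 < c := by positivity
  -- 64 = 4 · 16: the 4 comes from comparing expectations, the 16 and the exponential from the gate
  -- commutator bound.
  refine ⟨64 * c * Real.exp (16 * c), by positivity, ?_⟩
  intro N q _ G hG μ h Δ R ε hμ hμ1 hh hΔ hε H Hs _ hH hHn A As hAs hskew hA hAn hsmall hεΔ U hU hm
  set cm : ℝ := 64 * c * Real.exp (16 * c) with hcm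
  have hcm0 : 0 < cm := by positivity
  set κ : ℝ := 2 * μ with hκdef
  have hκ : 0 < κ := by positivity
  have hκ1 : κ ≤ 1 := by
    have h1 : (1 : ℝ) / (2 * Real.exp 1) ≤ 1 / 2 := by
      have := Real.one_le_exp (zero_le_one' ℝ)
      gcongr
      linarith
    linarith
  set a : ℝ := ε / (cm * h) * κ ^ (4 * d - 2) with ha
  have ha0 : 0 ≤ a := by positivity
  have haκ : a ≤ κ ^ d := hsmall.le.trans (pow_le_pow_of_le_one hκ.le hκ1 (by lia))
  have hAint : IntervalIntegrable A MeasureTheory.volume 0 1 :=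
    Metastable.intervalIntegrable_of_eq_sum hAs fun s hs => (hA s hs).sum_eq
  obtain ⟨W, hW, rfl⟩ := hU.exists_isPropagator hAint hskew
  have hR1 : 1 ≤ min R ((Δ / (2 * cd * ε)) ^ ((1 : ℝ) / (d : ℝ))) := by
    refine le_min hm.1 (Real.one_le_rpow ?_ (by positivity))
    rw [le_div_iff₀ (by positivity)] at hεΔ ⊢
    linarith
  have hδ : 4 * (16 * (c / κ ^ d * a * h) * Real.exp (16 * c)) ≤ ε := by
    have e : 4 * (16 * (c / κ ^ d * a * h) * Real.exp (16 * c)) = ε * κ ^ (3 * d - 2) := by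
      -- One factor κ^d cancels the volume cost; the rest is at most 1 and is discarded.
      have hpow : κ ^ (4 * d - 2) = κ ^ (3 * d - 2) * κ ^ d := by
        rw [← pow_add]
        congr 1
        lia
      rw [ha, hcm, hpow]
      field_simp
      ring
    rw [e]
    exact mul_le_of_le_one_right hε.le (pow_le_one₀ hκ.le hκ1)
  refine hm.of_expectation_sub_le (ε := ε) (min_le_left _ _) hR1 (fun S hS hdiam => ?_)
    fun S φ hφ0 hφ => ?_
  · have := hG.card_mul_le hd hcd hε hΔ hR1 (min_le_right _ _) hS hdiam
    linarith
  · refine (Metastable.norm_expectation_conj_sub_le hW (fun s hs i g =>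
      Metastable.norm_lie_conj_lie_gate_le hG hcd hκ hκ1 ha0 haκ hh.le hH hHn hW hA hAn hs i g)
      hφ0 hφ).trans ?_
    have := mul_le_mul_of_nonneg_left hδ (Nat.cast_nonneg (α := ℝ) S.card)
    linarith
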